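/- Let $A$ be an operator algebra, that is, a norm-closed complex subalgebra of $B(H)$ for some complex Hilbert space $H$; $A$ need not have any kind of approximate identity. Let $A^1$ be its unitization: $A^1 = A$ if $A$ has an identity of norm $1$, and $A^1 = A + \mathbb{C} I_H$ otherwise. Equip the second dual $(A^1)^{**}$ with its dual norm and the Arens product, regard $A \subset A^1 \subset (A^1)^{**}$ canonically, and let $1$ be the identity of $(A^1)^{**}$. A projection in $(A^1)^{**}$ is an orthogonal projection, i.e. an idempotent of norm at most $1$. A projection $p \in (A^1)^{**}$ is open if there is a net $(x_t)$ in $A^1$ with $x_t = p x_t$ for all $t$ and $x_t \to p$ weak*; a projection $q$ is closed if $1-q$ is open. Let $q$ be a closed projection in $(A^1)^{**}$ and let $b \in A$ satisfy $bq = qb$. Then $b$ attains its distance to the right ideal $J = \{a \in A : qa = 0\}$ of $A$: there is $y \in J$ with $\|b-y\| = d(b,J)$. If moreover $\|bq\| \le 1$, then there is $g \in A$ with $\|g\| \le 1$ and $gq = qg = bq$. -/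

import Mathlib

/-! Biduals of operator algebras with the Arens product, open and closed projections. -/

noncomputable section

namespace OpAlg

open Filter Topology

section Bidual

/-- The second dual of a normed algebra, with its dual norm. -/
abbrev Bidual (X : Type*) [NonUnitalNormedRing X] [NormedSpace ℂ X] : Type _ :=
  StrongDual ℂ (StrongDual ℂ X)

variable {X : Type*} [NonUnitalNormedRing X] [NormedSpace ℂ X] [IsScalarTower ℂ X X]
  [SMulCommClass ℂ X X]

/-- The action of the bidual on the dual: `(Ψ · φ)(a) = Ψ (φ · a)`, where `(φ · a)(c) = φ (a c)`. -/
def dualAct (Ψ : Bidual X) : StrongDual ℂ X →L[ℂ] StrongDual ℂ X :=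
  (ContinuousLinearMap.compL ℂ X (StrongDual ℂ X) ℂ Ψ) ∘L
    (((ContinuousLinearMap.compL ℂ X (X →L[ℂ] X) (StrongDual ℂ X)).flip
      (ContinuousLinearMap.mul ℂ X)) ∘L (ContinuousLinearMap.compL ℂ X X ℂ))

theorem dualAct_apply (Ψ : Bidual X) (φ : StrongDual ℂ X) (a : X) :
    dualAct Ψ φ a = Ψ (φ ∘L ContinuousLinearMap.mul ℂ X a) := rfl

/-- The (first) Arens product on the bidual: `(Φ Ψ)(φ) = Φ (Ψ · φ)`. -/
def arens (Φ Ψ : Bidual X) : Bidual X :=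
  Φ ∘L dualAct Ψ

theorem arens_apply (Φ Ψ : Bidual X) (φ : StrongDual ℂ X) :
    arens Φ Ψ φ = Φ (dualAct Ψ φ) := rfl

/-- A projection in the bidual of an operator algebra: a contractive idempotent. Represented on a
Hilbert space, these are exactly the orthogonal projections. -/
def IsProjection (p : Bidual X) : Prop :=
  arens p p = p ∧ ‖p‖ ≤ 1

/-- An open projection: a projection `p` in `X**` for which there is a net `x_t` in `X` with
`x_t = p x_t` and `x_t → p` weak*. The net is given by a proper filter on `X`. -/
def IsOpenProjection (p : Bidual X) : Prop :=
  IsProjection p ∧ ∃ l : Filter X, l.NeBot ∧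
    (∀ᶠ x in l, arens p (NormedSpace.inclusionInDoubleDual ℂ X x) =
      NormedSpace.inclusionInDoubleDual ℂ X x) ∧
    ∀ φ : StrongDual ℂ X, Tendsto (fun x => φ x) l (𝓝 (p φ))

/-- `e` is a (necessarily unique) contractive two-sided identity of `X**`. For an operator algebra
`X` it exists iff `X` is approximately unital, and for unital `X` it is the image of the unit. -/
def IsBidualOne (e : Bidual X) : Prop :=
  ‖e‖ ≤ 1 ∧ ∀ Φ, arens e Φ = Φ ∧ arens Φ e = Φ

/-- A closed projection: a projection whose complement `1 - q` is an open projection. -/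
def IsClosedProjection (q : Bidual X) : Prop :=
  IsProjection q ∧ ∃ e, IsBidualOne e ∧ IsOpenProjection (e - q)

end Bidual

section Unitization

variable {H : Type*} [NormedAddCommGroup H] [InnerProductSpace ℂ H]

/-- A subalgebra of `B(H)` is normed by the operator norm. -/
instance instNormedSpaceSubalgebra (A : NonUnitalSubalgebra ℂ (H →L[ℂ] H)) : NormedSpace ℂ A where
  norm_smul_le c x := norm_smul_le c (x : H →L[ℂ] H)

/-- `A` has an identity of norm one (which need not be the identity operator of `H`). -/
def HasNormOneUnit (A : NonUnitalSubalgebra ℂ (H →L[ℂ] H)) : Prop :=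
  ∃ e ∈ A, ‖e‖ = 1 ∧ ∀ a ∈ A, e * a = a ∧ a * e = a

/-- The algebra `A + ℂ I_H`. -/
def addScalars (A : NonUnitalSubalgebra ℂ (H →L[ℂ] H)) : NonUnitalSubalgebra ℂ (H →L[ℂ] H) where
  carrier := {x | ∃ a ∈ A, ∃ c : ℂ, x = a + c • (1 : H →L[ℂ] H)}
  zero_mem' := ⟨0, A.zero_mem, 0, by simp⟩
  add_mem' := by
    rintro _ _ ⟨a, ha, c, rfl⟩ ⟨b, hb, d, rfl⟩
    exact ⟨a + b, A.add_mem ha hb, c + d, by module⟩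
  mul_mem' := by
    rintro _ _ ⟨a, ha, c, rfl⟩ ⟨b, hb, d, rfl⟩
    refine ⟨a * b + d • a + c • b, A.add_mem (A.add_mem (A.mul_mem ha hb) (A.smul_mem d ha))
      (A.smul_mem c hb), c * d, ?_⟩
    simp only [add_mul, mul_add, smul_mul_assoc, mul_smul_comm, mul_one, one_mul]
    module
  smul_mem' := by
    rintro r _ ⟨a, ha, c, rfl⟩
    exact ⟨r • a, A.smul_mem r ha, r * c, by module⟩

open Classical in
/-- The unitization `A¹`: it is `A` if `A` has an identity of norm one, and `A + ℂ I_H` otherwise. -/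
def unitization (A : NonUnitalSubalgebra ℂ (H →L[ℂ] H)) : NonUnitalSubalgebra ℂ (H →L[ℂ] H) :=
  if HasNormOneUnit A then A else addScalars A

theorem le_unitization (A : NonUnitalSubalgebra ℂ (H →L[ℂ] H)) : A ≤ unitization A := by
  unfold unitization
  split_ifs
  · exact le_rfl
  · intro a ha
    exact ⟨a, ha, 0, by simp⟩

/-- The second dual `(A¹)**` of the unitization. -/
abbrev UnitizationBidual (A : NonUnitalSubalgebra ℂ (H →L[ℂ] H)) : Type _ :=
  Bidual (unitization A)

/-- The canonical image in `(A¹)**` of an element of `A`. -/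
def toBidual {A : NonUnitalSubalgebra ℂ (H →L[ℂ] H)} (a : A) : UnitizationBidual A :=
  NormedSpace.inclusionInDoubleDual ℂ (unitization A)
    (NonUnitalSubalgebra.inclusion (le_unitization A) a)

/-- The right ideal `{a ∈ A : q a = 0}` of `A`, for `q` in `(A¹)**`. -/
def rightIdeal {A : NonUnitalSubalgebra ℂ (H →L[ℂ] H)} (q : UnitizationBidual A) : Set A :=
  {a : A | arens q (toBidual a) = 0}

end Unitization

end OpAlg

end

/-! Everything follows from one interpolation result: there is `g ∈ A` with `gq = qg = bq` and `‖g‖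
≤ ‖bq‖`. Then `b - g` lies in `J`, and for every `y ∈ J` one has `‖g‖ ≤ ‖qb‖ = ‖q(b - y)‖ ≤ ‖b -
y‖`, so `b - g` is a nearest point.

The element `g` is a limit of corrections (`exists_mem_norm_le_of_step`). Put `p = 1 - q` and `M =
‖bq‖`. If `g` commutes with `q`, then `g = gq + gp` is block diagonal in the bidual, and shrinking
the block `gp` brings the norm down to `M`. The part removed is small and lies in the weak* closure
of the elements of `A` killed by `q` on both sides. A Helly-type argument (`exists_mem_norm_sub_le`)
replaces it by such an element at an arbitrarily small cost in norm.

The crux is that `p` lies in the weak* closure of `{x : qx = 0 = xq}`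
(`IsComplPair.apply_eq_zero_of_vanish`): openness only supplies `x` with `qx = 0`. The same
correction scheme, run on elements with `qa = q`, yields a contraction `a` with `qa = q`;
orthogonality then forces `aq = q`, so `1 - a` is killed on both sides.

The norm estimates for blocks are Hilbert space facts. They pass to the bidual because every
functional on a subalgebra of `B(H)` extends to `B(H)` and is there a coefficient of a GNS
representation. -/

noncomputable section

namespace OpAlg

open Filter Topology
open scoped ComplexOrder InnerProductSpace

/-! ### Domination of functionals on a C⋆-algebra by positive ones. -/

section PositiveFunctional

variable {C : Type*} [CStarAlgebra C] [PartialOrder C] [StarOrderedRing C]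

theorem exists_norm_one_mul_eq_norm (z : ℂ) : ∃ w : ℂ, ‖w‖ = 1 ∧ w * z = ‖z‖ := by
  rcases eq_or_ne z 0 with h | h
  · exact ⟨1, by simp, by simp [h]⟩
  · exact ⟨‖z‖ / z, by simp [h], div_mul_cancel₀ _ h⟩

/-- A rotation of the pair `(x, y)` preserves `x*x + y*y`; the difference of the two sides is the
square of the other rotated component. This makes `dominationCone` closed under addition. -/
theorem star_mul_self_lincomb_le (x y : C) {s t r : ℝ} (hr : r ^ 2 = s ^ 2 + t ^ 2) (hr0 : r ≠ 0) :
    star (r⁻¹ • (s • x + t • y)) * (r⁻¹ • (s • x + t • y)) ≤ star x * x + star y * y := by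
  have key : star x * x + star y * y -
      star (r⁻¹ • (s • x + t • y)) * (r⁻¹ • (s • x + t • y)) =
      star (r⁻¹ • (t • x - s • y)) * (r⁻¹ • (t • x - s • y)) := by
    have h : (r⁻¹ * r⁻¹) * (s ^ 2 + t ^ 2) = 1 := by rw [← hr]; field_simp
    have e : star x * x + star y * y =
        ((r⁻¹ * r⁻¹) * (s ^ 2 + t ^ 2)) • (star x * x + star y * y) := by rw [h, one_smul]
    rw [e]
    simp only [star_smul, star_add, star_sub, star_trivial, smul_mul_assoc, mul_smul_comm, add_mul,
      mul_add, sub_mul, mul_sub]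
    module
  rw [← sub_nonneg, key]
  exact star_mul_self_nonneg _

/-- Given a functional `φ`, the cone in `C × ℝ` on which `(z, t) ↦ f z + t` has to be nonnegative
for `f` to be (the real part of) a positive functional of norm at most one that dominates `φ`. -/
def dominationCone (φ : StrongDual ℂ C) : PointedCone ℝ (C × ℝ) where
  -- The quadratic bound `(Re φ x)² ≤ f (x*x)` is linearized as `f (x*x) - 2s Re φ x + s² ≥ 0` for
  -- all real `s`; the slack `c` encodes `f 1 ≤ 1`.
  carrier := {p | ∃ (x : C) (s c : ℝ), 0 ≤ c ∧
    2 • (star x * x) ≤ p.1 + star p.1 + (2 * c) • (1 : C) ∧ s ^ 2 - 2 * s * (φ x).re + c ≤ p.2}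
  zero_mem' := ⟨0, 0, 0, le_rfl, by simp, by simp⟩
  add_mem' := by
    rintro ⟨z₁, t₁⟩ ⟨z₂, t₂⟩ ⟨x₁, s₁, c₁, hc₁, hz₁, ht₁⟩ ⟨x₂, s₂, c₂, hc₂, hz₂, ht₂⟩
    have hz : 2 • (star x₁ * x₁ + star x₂ * x₂) ≤
        (z₁ + z₂) + star (z₁ + z₂) + (2 * (c₁ + c₂)) • (1 : C) := by
      refine le_trans (le_of_eq (smul_add _ _ _)) ((add_le_add hz₁ hz₂).trans (le_of_eq ?_))
      rw [star_add]
      module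
    rcases eq_or_ne (s₁ ^ 2 + s₂ ^ 2) 0 with h0 | h0
    · have h₁ : s₁ = 0 := by nlinarith
      have h₂ : s₂ = 0 := by nlinarith
      subst h₁ h₂
      refine ⟨0, 0, c₁ + c₂, add_nonneg hc₁ hc₂, le_trans ?_ hz, ?_⟩
      · simp only [star_zero, mul_zero, smul_zero]
        exact smul_nonneg (by norm_num)
          (add_nonneg (star_mul_self_nonneg _) (star_mul_self_nonneg _))
      · simp at ht₁ ht₂ ⊢
        linarith
    · have hpos : 0 < s₁ ^ 2 + s₂ ^ 2 := lt_of_le_of_ne (by positivity) h0.symm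
      set r := √(s₁ ^ 2 + s₂ ^ 2) with hr
      have hr2 : r ^ 2 = s₁ ^ 2 + s₂ ^ 2 := Real.sq_sqrt hpos.le
      have hr0 : r ≠ 0 := (Real.sqrt_pos.2 hpos).ne'
      refine ⟨r⁻¹ • (s₁ • x₁ + s₂ • x₂), r, c₁ + c₂, add_nonneg hc₁ hc₂, le_trans ?_ hz, ?_⟩
      · exact nsmul_le_nsmul_right (star_mul_self_lincomb_le x₁ x₂ hr2 hr0) 2
      · have : (φ (r⁻¹ • (s₁ • x₁ + s₂ • x₂))).re =
            r⁻¹ * (s₁ * (φ x₁).re + s₂ * (φ x₂).re) := by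
          simp only [← Complex.coe_smul (E := C), map_smul, map_add]
          simp
        rw [this, hr2]
        have : 2 * r * (r⁻¹ * (s₁ * (φ x₁).re + s₂ * (φ x₂).re)) =
          2 * (s₁ * (φ x₁).re + s₂ * (φ x₂).re) := by field_simp
        rw [this]
        simp only [Prod.snd_add]
        dsimp only at ht₁ ht₂ ⊢
        linarith
  smul_mem' := by
    rintro ⟨a, ha⟩ ⟨z, t⟩ ⟨x, s, c, hc, hz, ht⟩
    have hq : √a * √a = a := Real.mul_self_sqrt ha
    refine ⟨√a • x, √a * s, a * c, mul_nonneg ha hc, ?_, ?_⟩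
    · have := smul_le_smul_of_nonneg_left hz ha
      convert this using 1
      · simp only [star_smul, star_trivial, smul_mul_assoc, mul_smul_comm, smul_smul, hq]
        rw [smul_comm]
      · change a • z + star (a • z) + _ = _
        rw [star_smul, star_trivial]
        dsimp only
        module
    · have e : (φ (√a • x)).re = √a * (φ x).re := by
        simp only [← Complex.coe_smul (E := C), map_smul]
        simp
      rw [e]
      have := mul_le_mul_of_nonneg_left ht ha
      change _ ≤ a * t
      have h2 : (√a * s) ^ 2 - 2 * (√a * s) * (√a * (φ x).re) + a * c =
        (√a * √a) * (s ^ 2 - 2 * s * (φ x).re) + a * c := by ring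
      rw [h2, hq]
      dsimp only at this
      linarith

/-- The consistency condition for the Riesz extension: here `x*x ≤ c`, so `(Re φ x)² ≤ ‖x‖² ≤ c` and
`t ≥ (s - Re φ x)²`. -/
theorem nonneg_of_zero_mem_dominationCone {φ : StrongDual ℂ C} (hφ : ‖φ‖ ≤ 1) {t : ℝ}
    (h : ((0 : C), t) ∈ dominationCone φ) : 0 ≤ t := by
  obtain ⟨x, s, c, hc, hz, ht⟩ := h
  have h1 : star x * x ≤ algebraMap ℝ C c := by
    have : (2 : ℝ)⁻¹ • (2 • (star x * x)) ≤ (2 : ℝ)⁻¹ • ((2 * c) • (1 : C)) :=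
      smul_le_smul_of_nonneg_left (by simpa using hz) (by norm_num)
    rw [Algebra.algebraMap_eq_smul_one]
    convert this using 1 <;> module
  have h2 : ‖x‖ ^ 2 ≤ c := by
    have h3 : ‖star x * x‖ ≤ c :=
      (CStarAlgebra.norm_le_iff_le_algebraMap _ hc (star_mul_self_nonneg x)).2 h1
    rwa [CStarRing.norm_star_mul_self, ← sq] at h3
  have h3 : |(φ x).re| ≤ ‖x‖ := (Complex.abs_re_le_norm _).trans
    ((φ.le_opNorm x).trans (mul_le_of_le_one_left (norm_nonneg _) hφ))
  have h4 : (φ x).re ^ 2 ≤ ‖x‖ ^ 2 := sq_le_sq' (by linarith [(abs_le.1 h3).1]) (abs_le.1 h3).2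
  dsimp only at ht
  nlinarith [sq_nonneg (s - (φ x).re)]

/-- Every contractive functional `φ` on a C⋆-algebra is dominated by a positive functional `f` of
norm at most one: `|φ x|² ≤ f (x* x)`. -/
theorem exists_positive_dominating (φ : StrongDual ℂ C) (hφ : ‖φ‖ ≤ 1) :
    ∃ f : C →ₚ[ℂ] ℂ, (f 1).re ≤ 1 ∧ ∀ x, ‖φ x‖ ^ 2 ≤ (f (star x * x)).re := by
  let f₀ : (C × ℝ) →ₗ.[ℝ] ℝ :=
    ⟨LinearMap.range (LinearMap.inr ℝ C ℝ), (LinearMap.snd ℝ C ℝ).comp (Submodule.subtype _)⟩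
  obtain ⟨g, hg, hpos⟩ := riesz_extension (dominationCone φ) f₀
    (by
      rintro ⟨_, t, rfl⟩ h
      exact nonneg_of_zero_mem_dominationCone hφ h)
    (by
      rintro ⟨z, t⟩
      -- `z + z* + 2‖z‖` is positive, so `(z, ‖z‖)` is in the cone with `x = 0`, `s = 0`, `c = ‖z‖`.
      refine ⟨⟨(0, ‖z‖ - t), ⟨‖z‖ - t, rfl⟩⟩, 0, 0, ‖z‖, norm_nonneg _, ?_, ?_⟩
      · have hsa : IsSelfAdjoint (z + star z) := IsSelfAdjoint.add_star_self z
        have h1 := hsa.neg_algebraMap_norm_le_self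
        have h2 : algebraMap ℝ C ‖z + star z‖ ≤ algebraMap ℝ C (2 * ‖z‖) := by
          apply algebraMap_mono
          calc _ ≤ ‖z‖ + ‖star z‖ := norm_add_le _ _
            _ = _ := by rw [norm_star]; ring
        rw [Algebra.algebraMap_eq_smul_one (2 * ‖z‖)] at h2
        have h3 := neg_le_iff_add_nonneg.1 h1
        simpa using h3.trans (add_le_add_right h2 _)
      · simp)
  have hg1 : ∀ t : ℝ, g (0, t) = t := fun t => hg ⟨(0, t), ⟨t, rfl⟩⟩
  let G : C →ₗ[ℝ] ℝ := g.comp (LinearMap.inl ℝ C ℝ)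
  have hG : ∀ z t, g (z, t) = G z + t := fun z t => by
    have h : g (z, t) = g (z, 0) + g (0, t) := by
      rw [← map_add]
      simp
    rw [h, hg1]
    rfl
  have hGpos : ∀ z : C, 0 ≤ z + star z → 0 ≤ G z := fun z hz => by
    have := hpos (z, 0) ⟨0, 0, 0, le_rfl, by simpa using hz, by simp⟩
    rwa [hG, add_zero] at this
  have hF : ∀ z : C, 0 ≤ z → Module.Dual.extendRCLike (𝕜 := ℂ) G z = G z := fun z hz => by
    rw [Module.Dual.extendRCLike_apply]
    have hs : star z = z := (IsSelfAdjoint.of_nonneg hz).star_eq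
    -- For self-adjoint `z` the elements `±iz` have zero real part, so `G` vanishes on `iz` and the
    -- complexified functional is real at `z`.
    have h1 := hGpos ((Complex.I) • z) (by simp [hs])
    have h2 := hGpos (-((Complex.I) • z)) (by simp [hs])
    rw [map_neg] at h2
    have h3 : G ((Complex.I) • z) = 0 := by linarith
    simp [h3]
  refine ⟨PositiveLinearMap.mk₀ (Module.Dual.extendRCLike (𝕜 := ℂ) G) fun z hz => ?_, ?_,
    fun x => ?_⟩
  · rw [hF z hz, Complex.zero_le_real]
    exact hGpos z (add_nonneg hz (star_nonneg_iff.2 hz))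
  · change (Module.Dual.extendRCLike (𝕜 := ℂ) G 1).re ≤ 1
    rw [hF 1 zero_le_one, Complex.ofReal_re]
    have := hpos (-1, 1) ⟨0, 0, 1, zero_le_one, by simp; rw [two_smul]; simp, by simp⟩
    rw [hG, map_neg] at this
    linarith
  · change _ ≤ (Module.Dual.extendRCLike (𝕜 := ℂ) G (star x * x)).re
    rw [hF _ (star_mul_self_nonneg x), Complex.ofReal_re]
    obtain ⟨w, hw, hwx⟩ := exists_norm_one_mul_eq_norm (φ x)
    have hx : star (w • x) * (w • x) = star x * x := by
      rw [star_smul, smul_mul_assoc, mul_smul_comm, smul_smul]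
      have : star w * w = 1 := by
        rw [Complex.star_def, ← Complex.normSq_eq_conj_mul_self, Complex.normSq_eq_norm_sq, hw]
        simp
      rw [this, one_smul]
    -- The phase `w` makes `φ (w • x)` equal to `‖φ x‖`, and `s = ‖φ x‖` is the optimal parameter.
    have := hpos (star x * x, ‖φ x‖ ^ 2 - 2 * ‖φ x‖ * ‖φ x‖) ⟨w • x, ‖φ x‖, 0, le_rfl, ?_, ?_⟩
    · rw [hG] at this
      linarith
    · rw [hx]
      simp [two_smul]
    · simp [hwx]

end PositiveFunctional

/-! ### GNS coefficients and the extension of representations to the bidual. -/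

section Representations

/-- Every functional on a unital C⋆-algebra is a coefficient of a GNS representation. -/
theorem exists_gns_coefficient {C : Type*} [CStarAlgebra C] [PartialOrder C] [StarOrderedRing C]
    (φ : StrongDual ℂ C) (hφ : ‖φ‖ ≤ 1) :
    ∃ (f : C →ₚ[ℂ] ℂ) (ξ η : f.GNS), ‖ξ‖ ≤ 1 ∧ ‖η‖ ≤ 1 ∧
      ∀ x, φ x = ⟪η, f.gnsNonUnitalStarAlgHom x ξ⟫_ℂ := by
  obtain ⟨f, hf1, hf⟩ := exists_positive_dominating φ hφ
  have hbound : ∀ x : f.PreGNS, ‖φ (f.ofPreGNS x)‖ ≤ 1 * ‖x‖ := fun x => by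
    rw [one_mul, PositiveLinearMap.preGNS_norm_def]
    exact Real.le_sqrt_of_sq_le (hf _)
  let L : f.PreGNS →L[ℂ] ℂ := (φ.toLinearMap ∘ₗ f.ofPreGNS.toLinearMap).mkContinuous 1 hbound
  let e : f.PreGNS →L[ℂ] f.GNS := UniformSpace.Completion.toComplL
  have he : DenseRange e := UniformSpace.Completion.denseRange_coe
  have hu : IsUniformInducing e := UniformSpace.Completion.isUniformInducing_coe _
  have hL : ∀ x : f.PreGNS, (L.extend e) (x : f.GNS) = φ (f.ofPreGNS x) :=
    fun x => L.extend_eq he hu x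
  have hLn : ‖L.extend e‖ ≤ 1 := by
    refine ContinuousLinearMap.opNorm_le_bound _ zero_le_one fun y => ?_
    induction y using UniformSpace.Completion.induction_on with
    | hp => exact isClosed_le (by fun_prop) (by fun_prop)
    | ih x => rw [hL, UniformSpace.Completion.norm_coe]; exact hbound x
  refine ⟨f, (f.toPreGNS 1 : f.PreGNS), (InnerProductSpace.toDual ℂ f.GNS).symm (L.extend e),
    ?_, ?_, fun x => ?_⟩
  · rw [UniformSpace.Completion.norm_coe, PositiveLinearMap.preGNS_norm_def]
    exact Real.sqrt_le_one.2 (by simpa using hf1)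
  · rwa [LinearIsometryEquiv.norm_map]
  · rw [InnerProductSpace.toDual_symm_apply, PositiveLinearMap.gnsNonUnitalStarAlgHom_apply_coe, hL]
    simp

variable {X : Type*} [NonUnitalNormedRing X] [NormedSpace ℂ X]
  {K : Type*} [NormedAddCommGroup K] [InnerProductSpace ℂ K]

/-- The coefficient functional `a ↦ ⟪η, π a ξ⟫`. -/
def coefficient (π : X →L[ℂ] K →L[ℂ] K) (ξ η : K) : StrongDual ℂ X :=
  innerSL ℂ η ∘L π.flip ξ

@[simp]
theorem coefficient_apply (π : X →L[ℂ] K →L[ℂ] K) (ξ η : K) (a : X) :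
    coefficient π ξ η a = ⟪η, π a ξ⟫_ℂ := rfl

theorem norm_coefficient_le (π : X →L[ℂ] K →L[ℂ] K) (ξ η : K) :
    ‖coefficient π ξ η‖ ≤ ‖π‖ * ‖η‖ * ‖ξ‖ := by
  refine ContinuousLinearMap.opNorm_le_bound _ (by positivity) fun a => ?_
  calc _ ≤ ‖η‖ * ‖π a ξ‖ := norm_inner_le_norm _ _
    _ ≤ ‖η‖ * (‖π‖ * ‖a‖ * ‖ξ‖) := by gcongr; exact π.le_opNorm₂ a ξ
    _ = _ := by ring

variable [CompleteSpace K]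

/-- The extension of a representation of `X` to `X**`. -/
def bidualRep (π : X →L[ℂ] K →L[ℂ] K) (Φ : Bidual X) : K →L[ℂ] K :=
  ContinuousLinearMap.adjoint <| InnerProductSpace.continuousLinearMapOfBilin <|
    LinearMap.mkContinuous₂
      (LinearMap.mk₂'ₛₗ (starRingEnd ℂ) (RingHom.id ℂ) (fun η ξ => Φ (coefficient π ξ η))
        (fun η₁ η₂ ξ => by
          rw [← map_add]; congr 1; ext a; simp)
        (fun c η ξ => by
          rw [← map_smul]; congr 1; ext a; simp [mul_comm])
        (fun η ξ₁ ξ₂ => by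
          rw [← map_add]; congr 1; ext a; simp)
        (fun c η ξ => by
          rw [← map_smul]; congr 1; ext a; simp))
      (‖Φ‖ * ‖π‖) (fun η ξ => by
        calc ‖Φ (coefficient π ξ η)‖ ≤ ‖Φ‖ * ‖coefficient π ξ η‖ := Φ.le_opNorm _
          _ ≤ ‖Φ‖ * (‖π‖ * ‖η‖ * ‖ξ‖) := by gcongr; exact norm_coefficient_le π ξ η
          _ = _ := by ring)

theorem inner_bidualRep (π : X →L[ℂ] K →L[ℂ] K) (Φ : Bidual X) (ξ η : K) :
    ⟪η, bidualRep π Φ ξ⟫_ℂ = Φ (coefficient π ξ η) := by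
  rw [bidualRep, ContinuousLinearMap.adjoint_inner_right,
    InnerProductSpace.continuousLinearMapOfBilin_apply]
  rfl

theorem norm_bidualRep_le (π : X →L[ℂ] K →L[ℂ] K) (hπ : ‖π‖ ≤ 1) (Φ : Bidual X) :
    ‖bidualRep π Φ‖ ≤ ‖Φ‖ := by
  refine ContinuousLinearMap.opNorm_le_bound _ (ContinuousLinearMap.opNorm_nonneg Φ) fun ξ => ?_
  have h : ‖bidualRep π Φ ξ‖ * ‖bidualRep π Φ ξ‖ ≤ (‖Φ‖ * ‖ξ‖) * ‖bidualRep π Φ ξ‖ := by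
    have e : ‖bidualRep π Φ ξ‖ * ‖bidualRep π Φ ξ‖ = ‖⟪bidualRep π Φ ξ, bidualRep π Φ ξ⟫_ℂ‖ := by
      rw [inner_self_eq_norm_sq_to_K, ← sq]
      simp
    rw [e, inner_bidualRep]
    calc _ ≤ ‖Φ‖ * ‖coefficient π ξ (bidualRep π Φ ξ)‖ := Φ.le_opNorm _
      _ ≤ ‖Φ‖ * (1 * ‖bidualRep π Φ ξ‖ * ‖ξ‖) := by
        gcongr
        exact (norm_coefficient_le _ _ _).trans (by gcongr)
      _ = _ := by ring
  rcases (norm_nonneg (bidualRep π Φ ξ)).eq_or_lt with h0 | h0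
  · rw [← h0]
    positivity
  · exact le_of_mul_le_mul_right h h0

theorem bidualRep_add (π : X →L[ℂ] K →L[ℂ] K) (Φ Ψ : Bidual X) :
    bidualRep π (Φ + Ψ) = bidualRep π Φ + bidualRep π Ψ := by
  ext ξ
  refine ext_inner_left ℂ fun η => ?_
  simp [inner_bidualRep, inner_add_right]

theorem bidualRep_zero (π : X →L[ℂ] K →L[ℂ] K) : bidualRep π (0 : Bidual X) = 0 := by
  ext ξ
  refine ext_inner_left ℂ fun η => ?_
  simp [inner_bidualRep]

/-- Moving `π a` to the other side of the inner product shows that `Ψ` acts on the coefficient of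
`(ξ, η)` by turning it into that of `(bidualRep π Ψ ξ, η)`. -/
theorem bidualRep_arens [IsScalarTower ℂ X X] [SMulCommClass ℂ X X] (π : X →L[ℂ] K →L[ℂ] K)
    (hπ : ∀ a b, π (a * b) = π a * π b) (Φ Ψ : Bidual X) :
    bidualRep π (arens Φ Ψ) = bidualRep π Φ * bidualRep π Ψ := by
  ext ξ
  refine ext_inner_left ℂ fun η => ?_
  rw [mul_apply_eq_comp, inner_bidualRep, inner_bidualRep, arens_apply]
  congr 1
  ext a
  rw [dualAct_apply, coefficient_apply, ← ContinuousLinearMap.adjoint_inner_left, inner_bidualRep]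
  congr 1
  ext c
  simp [hπ, ContinuousLinearMap.adjoint_inner_left]

end Representations

/-! ### Representations detect the norm of the bidual. -/

section NormDetection

universe u

/-- The norms of the elements of `X**` are determined by their images under the extensions of the
contractive representations of `X` on Hilbert spaces. -/
def BidualNormedByReps (X : Type u) [NonUnitalNormedRing X] [NormedSpace ℂ X] : Prop :=
  ∀ (Φ : Bidual X) {M : ℝ}, 0 ≤ M →
    (∀ (K : Type u) [NormedAddCommGroup K] [InnerProductSpace ℂ K] [CompleteSpace K]
      (π : X →L[ℂ] K →L[ℂ] K), ‖π‖ ≤ 1 → (∀ a b, π (a * b) = π a * π b) →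
        ‖bidualRep π Φ‖ ≤ M) → ‖Φ‖ ≤ M

theorem bidualNormedByReps_of_subalgebra {H : Type u} [NormedAddCommGroup H]
    [InnerProductSpace ℂ H] [CompleteSpace H] (B : NonUnitalSubalgebra ℂ (H →L[ℂ] H)) :
    BidualNormedByReps B := by
  intro Φ M hM h
  refine ContinuousLinearMap.opNorm_le_of_unit_norm hM fun φ hφ => ?_
  obtain ⟨ψ, hψ, hψn⟩ := exists_extension_norm_eq B.toSubmodule φ
  obtain ⟨f, ξ, η, hξ, hη, hx⟩ := exists_gns_coefficient ψ (hψn.trans_le hφ.le)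
  let ρ := f.gnsNonUnitalStarAlgHom
  let π : B →L[ℂ] f.GNS →L[ℂ] f.GNS := LinearMap.mkContinuous
    ((ρ : (H →L[ℂ] H) →ₗ[ℂ] (f.GNS →L[ℂ] f.GNS)) ∘ₗ B.toSubmodule.subtype) 1 fun a => by
      rw [one_mul]
      exact NonUnitalStarAlgHom.norm_apply_le ρ (a : H →L[ℂ] H)
  have hφ' : φ = coefficient π ξ η := by
    ext a
    exact (hψ a).symm.trans (hx a)
  have hk := h f.GNS π (LinearMap.mkContinuous_norm_le _ zero_le_one _)
    (fun a b => map_mul ρ (a : H →L[ℂ] H) b)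
  rw [hφ', ← inner_bidualRep]
  calc _ ≤ ‖η‖ * ‖bidualRep π Φ ξ‖ := norm_inner_le_norm _ _
    _ ≤ 1 * (M * 1) := by
      gcongr
      exact ((bidualRep π Φ).le_opNorm ξ).trans (by gcongr)
    _ = M := by ring

end NormDetection

/-! ### Contractive idempotents on a Hilbert space. -/

section Idempotents

variable {K : Type*} [NormedAddCommGroup K] [InnerProductSpace ℂ K]

/-- Testing with `c = -t • conj ⟪u, v⟫` makes the first-order term negative; for `t = 1 / (‖v‖² +
1)` it beats the second-order one unless the inner product is zero. -/
theorem inner_eq_zero_of_norm_le_norm_add_smul {u v : K} (h : ∀ c : ℂ, ‖u‖ ≤ ‖u + c • v‖) :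
    ⟪u, v⟫_ℂ = 0 := by
  set w := ⟪u, v⟫_ℂ with hw
  have key : ∀ t : ℝ, 2 * t * ‖w‖ ^ 2 ≤ t ^ 2 * ‖w‖ ^ 2 * ‖v‖ ^ 2 := fun t => by
    have h1 := pow_le_pow_left₀ (norm_nonneg _) (h (-(t : ℂ) * starRingEnd ℂ w)) 2
    rw [norm_add_sq (𝕜 := ℂ), inner_smul_right, ← hw, norm_smul, mul_assoc,
      ← Complex.normSq_eq_conj_mul_self, Complex.normSq_eq_norm_sq, norm_mul, norm_neg,
      RCLike.norm_conj, Complex.norm_real] at h1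
    have h2 : RCLike.re (-(t : ℂ) * ((‖w‖ ^ 2 : ℝ) : ℂ)) = - t * ‖w‖ ^ 2 := by
      rw [← Complex.ofReal_neg, ← Complex.ofReal_mul]
      rfl
    rw [h2, mul_pow, mul_pow, Real.norm_eq_abs, sq_abs] at h1
    linarith
  have h1 := key (1 / (‖v‖ ^ 2 + 1))
  have hv : 0 < ‖v‖ ^ 2 + 1 := by positivity
  have h2 : 2 * ‖w‖ ^ 2 * (‖v‖ ^ 2 + 1) ≤ ‖w‖ ^ 2 * ‖v‖ ^ 2 := by
    have := mul_le_mul_of_nonneg_right h1 (sq_nonneg (‖v‖ ^ 2 + 1))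
    have e1 : 2 * (1 / (‖v‖ ^ 2 + 1)) * ‖w‖ ^ 2 * (‖v‖ ^ 2 + 1) ^ 2 =
      2 * ‖w‖ ^ 2 * (‖v‖ ^ 2 + 1) := by field_simp
    have e2 : (1 / (‖v‖ ^ 2 + 1)) ^ 2 * ‖w‖ ^ 2 * ‖v‖ ^ 2 * (‖v‖ ^ 2 + 1) ^ 2 =
      ‖w‖ ^ 2 * ‖v‖ ^ 2 := by field_simp
    rwa [e1, e2] at this
  have h3 : ‖w‖ ^ 2 * ‖v‖ ^ 2 ≥ 0 := by positivity
  have h4 : ‖w‖ ^ 2 ≤ 0 := by nlinarith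
  exact norm_eq_zero.1 (pow_eq_zero_iff (two_ne_zero) |>.1 (le_antisymm h4 (sq_nonneg _)))

variable {Q R : K →L[ℂ] K}

/-- Complementary contractive idempotents have orthogonal ranges. -/
theorem norm_add_sq_of_idempotents (hQ : Q * Q = Q) (hQn : ‖Q‖ ≤ 1) (hQR : Q * R = 0) (x y : K) :
    ‖Q x + R y‖ ^ 2 = ‖Q x‖ ^ 2 + ‖R y‖ ^ 2 := by
  have h : ⟪Q x, R y⟫_ℂ = 0 := inner_eq_zero_of_norm_le_norm_add_smul fun c => by
    have e : Q (Q x + c • R y) = Q x := by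
      rw [map_add, map_smul, ← mul_apply_eq_comp, ← mul_apply_eq_comp, hQ,
        hQR]
      simp
    calc ‖Q x‖ = ‖Q (Q x + c • R y)‖ := by rw [e]
      _ ≤ ‖Q x + c • R y‖ := Q.le_of_opNorm_le hQn _ |>.trans_eq (one_mul _)
  rw [norm_add_sq (𝕜 := ℂ), h]
  simp

/-- Block diagonal operators have the maximum of the norms of the blocks as norm. -/
theorem norm_add_le_of_blocks (hQ : Q * Q = Q) (hR : R * R = R) (hQn : ‖Q‖ ≤ 1) (hQR : Q * R = 0)
    (hn : ‖Q + R‖ ≤ 1) {S T : K →L[ℂ] K} (hS : Q * S * Q = S) (hT : R * T * R = T) {M : ℝ}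
    (hSM : ‖S‖ ≤ M) (hTM : ‖T‖ ≤ M) : ‖S + T‖ ≤ M := by
  have hM : 0 ≤ M := (norm_nonneg _).trans hSM
  refine ContinuousLinearMap.opNorm_le_bound _ hM fun x => ?_
  have hS' : ∀ x, Q (S (Q x)) = S x := fun x => DFunLike.congr_fun hS x
  have hT' : ∀ x, R (T (R x)) = T x := fun x => DFunLike.congr_fun hT x
  have hSQ : ‖S x‖ ≤ M * ‖Q x‖ := by
    have : S (Q x) = S x := by
      rw [← hS' (Q x), ← hS' x, ← mul_apply_eq_comp Q Q, hQ]
    rw [← this]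
    exact S.le_of_opNorm_le hSM _
  have hTR : ‖T x‖ ≤ M * ‖R x‖ := by
    have : T (R x) = T x := by
      rw [← hT' (R x), ← hT' x, ← mul_apply_eq_comp R R, hR]
    rw [← this]
    exact T.le_of_opNorm_le hTM _
  have h1 : ‖(S + T) x‖ ^ 2 = ‖S x‖ ^ 2 + ‖T x‖ ^ 2 := by
    rw [add_apply, ← hS' x, ← hT' x]
    exact norm_add_sq_of_idempotents hQ hQn hQR _ _
  -- Only contractivity of `Q + R` is used: a degenerate representation does not send the unit to
  -- the identity operator.
  have h2 : ‖Q x‖ ^ 2 + ‖R x‖ ^ 2 ≤ ‖x‖ ^ 2 := by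
    rw [← norm_add_sq_of_idempotents hQ hQn hQR]
    exact pow_le_pow_left₀ (norm_nonneg _) (((Q + R).le_of_opNorm_le hn x).trans_eq (one_mul _)) 2
  refine le_of_pow_le_pow_left₀ two_ne_zero (by positivity) ?_
  calc _ = ‖S x‖ ^ 2 + ‖T x‖ ^ 2 := h1
    _ ≤ (M * ‖Q x‖) ^ 2 + (M * ‖R x‖) ^ 2 := by gcongr
    _ = M ^ 2 * (‖Q x‖ ^ 2 + ‖R x‖ ^ 2) := by ring
    _ ≤ M ^ 2 * ‖x‖ ^ 2 := by gcongr
    _ = _ := by ring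

/-- A contraction-like operator that compresses to the identity under `Q` has a small corner. -/
theorem norm_corner_le (hQ : Q * Q = Q) (hQn : ‖Q‖ ≤ 1) (hQR : Q * R = 0) (hn : ‖Q + R‖ ≤ 1)
    {T : K →L[ℂ] K} (hT : Q * T = Q) {r : ℝ} (hr : 0 ≤ r) (hTr : ‖T‖ ≤ 1 + r) :
    ‖R * T * Q‖ ≤ √(2 * r + r ^ 2) := by
  refine ContinuousLinearMap.opNorm_le_bound _ (Real.sqrt_nonneg _) fun x => ?_
  have h1 : ‖Q (T (Q x))‖ ^ 2 + ‖R (T (Q x))‖ ^ 2 ≤ ((1 + r) * ‖Q x‖) ^ 2 := by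
    rw [← norm_add_sq_of_idempotents hQ hQn hQR]
    refine pow_le_pow_left₀ (norm_nonneg _) ?_ 2
    exact (((Q + R).le_of_opNorm_le hn _).trans_eq (one_mul _)).trans (T.le_of_opNorm_le hTr _)
  have h2 : Q (T (Q x)) = Q x := by
    rw [← mul_apply_eq_comp Q T, hT, ← mul_apply_eq_comp Q Q, hQ]
  have h3 : ‖Q x‖ ≤ ‖x‖ := (Q.le_of_opNorm_le hQn x).trans_eq (one_mul _)
  rw [h2] at h1
  refine le_of_pow_le_pow_left₀ two_ne_zero (by positivity) ?_
  calc ‖R (T (Q x))‖ ^ 2 ≤ (2 * r + r ^ 2) * ‖Q x‖ ^ 2 := by linarith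
    _ ≤ (2 * r + r ^ 2) * ‖x‖ ^ 2 := by gcongr
    _ = _ := by rw [mul_pow, Real.sq_sqrt (by positivity)]

end Idempotents

/-! ### Approximation from the weak* closure under two norm constraints. -/

section Helly

variable {X Z₁ Z₂ : Type*} [NormedAddCommGroup X] [NormedSpace ℂ X]
  [NormedAddCommGroup Z₁] [NormedSpace ℂ Z₁] [NormedAddCommGroup Z₂] [NormedSpace ℂ Z₂]

/-- The dual norm of the maximum norm dominates the sum of the norms of the components. -/
theorem norm_comp_inl_add_norm_comp_inr_le (f : StrongDual ℂ (Z₁ × Z₂)) :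
    ‖f ∘L ContinuousLinearMap.inl ℂ Z₁ Z₂‖ + ‖f ∘L ContinuousLinearMap.inr ℂ Z₁ Z₂‖ ≤ ‖f‖ := by
  have key : ∀ u v, ‖u‖ = 1 → ‖v‖ = 1 → ‖f (u, 0)‖ + ‖f (0, v)‖ ≤ ‖f‖ := fun u v hu hv => by
    obtain ⟨c, hc, hcu⟩ := exists_norm_one_mul_eq_norm (f (u, 0))
    obtain ⟨d, hd, hdv⟩ := exists_norm_one_mul_eq_norm (f (0, v))
    have e : f (c • u, d • v) = ((‖f (u, 0)‖ + ‖f (0, v)‖ : ℝ) : ℂ) := by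
      have : (c • u, d • v) = c • (u, (0 : Z₂)) + d • ((0 : Z₁), v) := by simp
      rw [this, map_add, map_smul, map_smul, smul_eq_mul, smul_eq_mul, hcu, hdv]
      simp
    have h := f.le_opNorm (c • u, d • v)
    rw [e, Complex.norm_real, Real.norm_of_nonneg (by positivity), Prod.norm_def, norm_smul,
      norm_smul, hc, hd, hu, hv] at h
    simpa using h
  have h₁ : ∀ u, ‖u‖ = 1 → ‖f (u, 0)‖ ≤ ‖f‖ := fun u hu => by
    have := f.le_opNorm (u, 0)
    simpa [Prod.norm_def, hu] using this
  have h₂ : ∀ u, ‖u‖ = 1 →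
      ‖f ∘L ContinuousLinearMap.inr ℂ Z₁ Z₂‖ ≤ ‖f‖ - ‖f (u, 0)‖ := fun u hu =>
    ContinuousLinearMap.opNorm_le_of_unit_norm (sub_nonneg.2 (h₁ u hu)) fun v hv =>
      le_sub_iff_add_le'.2 (key u v hu hv)
  have h₃ : ‖f ∘L ContinuousLinearMap.inr ℂ Z₁ Z₂‖ ≤ ‖f‖ := by
    refine ContinuousLinearMap.opNorm_le_of_unit_norm (norm_nonneg _) fun v hv => ?_
    have := f.le_opNorm (0, v)
    simpa [Prod.norm_def, hv] using this
  rw [← le_sub_iff_add_le]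
  exact ContinuousLinearMap.opNorm_le_of_unit_norm (sub_nonneg.2 h₃) fun u hu =>
    le_sub_comm.1 (h₂ u hu)

/-- Approximation of an element `Φ` of the weak⋆ closure of a subspace `S` of `X` in `X**` by
elements of `S`, simultaneously for two norm estimates. -/
theorem exists_mem_norm_sub_le (S : Submodule ℂ X) (Φ : StrongDual ℂ (StrongDual ℂ X))
    (hΦ : ∀ φ : StrongDual ℂ X, (∀ x ∈ S, φ x = 0) → Φ φ = 0)
    (T₁ : X →L[ℂ] Z₁) (T₂ : X →L[ℂ] Z₂) (z₁ : Z₁) (z₂ : Z₂) {α β : ℝ} (hα : 0 ≤ α) (hβ : 0 ≤ β)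
    (h₁ : ∀ f : StrongDual ℂ Z₁, ‖f z₁ - Φ (f ∘L T₁)‖ ≤ α * ‖f‖)
    (h₂ : ∀ f : StrongDual ℂ Z₂, ‖f z₂ - Φ (f ∘L T₂)‖ ≤ β * ‖f‖) {ε : ℝ} (hε : 0 < ε) :
    ∃ y ∈ S, ‖z₁ - T₁ y‖ ≤ α + ε ∧ ‖z₂ - T₂ y‖ ≤ β + ε := by
  have hα' : 0 < α + ε := by positivity
  have hβ' : 0 < β + ε := by positivity
  -- With these weights both estimates together say that the class of `z` modulo the image of `S`
  -- meets the unit ball of the maximum norm.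
  set c : ℂ := Complex.ofReal (α + ε)⁻¹ with hc
  set d : ℂ := Complex.ofReal (β + ε)⁻¹ with hd
  have hcn : ‖c‖ = (α + ε)⁻¹ := by rw [hc, Complex.norm_real, Real.norm_of_nonneg (by positivity)]
  have hdn : ‖d‖ = (β + ε)⁻¹ := by rw [hd, Complex.norm_real, Real.norm_of_nonneg (by positivity)]
  let T : X →L[ℂ] Z₁ × Z₂ := (c • T₁).prod (d • T₂)
  let S' : Submodule ℂ (Z₁ × Z₂) := S.map T.toLinearMap
  let z : Z₁ × Z₂ := (c • z₁, d • z₂)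
  obtain ⟨g, hg, hgz⟩ := exists_dual_vector'' ℂ (Submodule.Quotient.mk z : (Z₁ × Z₂) ⧸ S')
  let f : StrongDual ℂ (Z₁ × Z₂) := LinearMap.mkContinuous (g.toLinearMap ∘ₗ S'.mkQ) 1 fun x => by
    calc ‖g (Submodule.Quotient.mk x)‖ ≤ ‖g‖ * ‖(Submodule.Quotient.mk x : (Z₁ × Z₂) ⧸ S')‖ :=
          g.le_opNorm _
      _ ≤ 1 * ‖x‖ := by
        gcongr
        exact Submodule.Quotient.norm_mk_le _ _
  have hf : ‖f‖ ≤ 1 := LinearMap.mkContinuous_norm_le _ zero_le_one _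
  have hfS : ∀ x ∈ S, f (T x) = 0 := fun x hx => by
    change g (Submodule.Quotient.mk (T x)) = 0
    have : (Submodule.Quotient.mk (T x) : (Z₁ × Z₂) ⧸ S') = 0 :=
      (Submodule.Quotient.mk_eq_zero S').2 (Submodule.mem_map_of_mem hx)
    rw [this, map_zero]
  set k₁ := f ∘L ContinuousLinearMap.inl ℂ Z₁ Z₂ with hk₁
  set k₂ := f ∘L ContinuousLinearMap.inr ℂ Z₁ Z₂ with hk₂
  have hk : ‖k₁‖ + ‖k₂‖ ≤ 1 := (norm_comp_inl_add_norm_comp_inr_le f).trans hf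
  have hsplit : ∀ u v, f (c • u, d • v) = c * k₁ u + d * k₂ v := fun u v => by
    have : (c • u, d • v) = c • (u, (0 : Z₂)) + d • ((0 : Z₁), v) := by simp
    rw [this, map_add, map_smul, map_smul]
    rfl
  -- The functional `f ∘ T` annihilates `S`, hence so does `Φ` on it; this inserts `Φ` into `f z`,
  -- where `h₁` and `h₂` apply.
  have hzero : c * Φ (k₁ ∘L T₁) + d * Φ (k₂ ∘L T₂) = 0 := by
    rw [← smul_eq_mul, ← smul_eq_mul, ← map_smul, ← map_smul, ← map_add]
    refine hΦ _ fun x hx => ?_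
    rw [← hfS x hx]
    exact (hsplit _ _).symm
  have hfz : f z = c * (k₁ z₁ - Φ (k₁ ∘L T₁)) + d * (k₂ z₂ - Φ (k₂ ∘L T₂)) := by
    rw [hsplit]
    linear_combination hzero
  have hlt : ‖(Submodule.Quotient.mk z : (Z₁ × Z₂) ⧸ S')‖ < 1 := by
    have e : f z = ((‖(Submodule.Quotient.mk z : (Z₁ × Z₂) ⧸ S')‖ : ℝ) : ℂ) := hgz
    have e' : ‖f z‖ = ‖(Submodule.Quotient.mk z : (Z₁ × Z₂) ⧸ S')‖ := by
      rw [e, Complex.norm_real, norm_norm]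
    rw [← e', hfz]
    have hα1 : (α + ε)⁻¹ * α < 1 := by rw [inv_mul_lt_one₀ hα']; linarith
    have hβ1 : (β + ε)⁻¹ * β < 1 := by rw [inv_mul_lt_one₀ hβ']; linarith
    set m := max ((α + ε)⁻¹ * α) ((β + ε)⁻¹ * β)
    have hm : m < 1 := max_lt hα1 hβ1
    have hm0 : 0 ≤ m := le_max_of_le_left (by positivity)
    calc _ ≤ ‖c * (k₁ z₁ - Φ (k₁ ∘L T₁))‖ + ‖d * (k₂ z₂ - Φ (k₂ ∘L T₂))‖ := norm_add_le _ _
      _ ≤ (α + ε)⁻¹ * (α * ‖k₁‖) + (β + ε)⁻¹ * (β * ‖k₂‖) := by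
        rw [norm_mul, norm_mul, hcn, hdn]
        gcongr
        · exact h₁ k₁
        · exact h₂ k₂
      _ = ((α + ε)⁻¹ * α) * ‖k₁‖ + ((β + ε)⁻¹ * β) * ‖k₂‖ := by ring
      _ ≤ m * ‖k₁‖ + m * ‖k₂‖ := by
        gcongr
        · exact le_max_left _ _
        · exact le_max_right _ _
      _ = m * (‖k₁‖ + ‖k₂‖) := by ring
      _ ≤ m * 1 := by gcongr
      _ < 1 := by linarith
  obtain ⟨w, hw, hw1⟩ := QuotientAddGroup.norm_lt_iff.1 hlt
  obtain ⟨y, hy, hyw⟩ := (Submodule.Quotient.eq S').1 (show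
    (Submodule.Quotient.mk z : (Z₁ × Z₂) ⧸ S') = Submodule.Quotient.mk w from hw.symm)
  have hw' : w = z - T y := by
    rw [eq_sub_iff_add_eq, ← eq_sub_iff_add_eq', ← hyw]
    rfl
  have hw1' : w.1 = c • (z₁ - T₁ y) := by rw [hw', smul_sub]; rfl
  have hw2' : w.2 = d • (z₂ - T₂ y) := by rw [hw', smul_sub]; rfl
  have hn1 := (norm_fst_le w).trans hw1.le
  have hn2 := (norm_snd_le w).trans hw1.le
  rw [hw1', norm_smul, hcn, inv_mul_le_one₀ hα'] at hn1
  rw [hw2', norm_smul, hdn, inv_mul_le_one₀ hβ'] at hn2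
  exact ⟨y, hy, hn1, hn2⟩

end Helly

/-! ### Successive approximation. -/

section Iteration

/-- Successive approximation: if norm bounds `M + r²` can be improved to `M + (r/2)²` by
perturbations of size `O(r)` inside a closed set `G`, then the bound `M` is attained in `G`. -/
theorem exists_mem_norm_le_of_step {X : Type*} [NormedAddCommGroup X] [CompleteSpace X]
    {G : Set X} (hG : IsClosed G) {M C r₀ : ℝ} (hr₀ : 0 < r₀)
    (step : ∀ r, 0 < r → r ≤ r₀ → ∀ a ∈ G, ‖a‖ ≤ M + r ^ 2 →
      ∃ a' ∈ G, ‖a'‖ ≤ M + (r / 2) ^ 2 ∧ ‖a - a'‖ ≤ C * r)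
    {a₀ : X} (ha₀ : a₀ ∈ G) (hn : ‖a₀‖ ≤ M + r₀ ^ 2) :
    ∃ a ∈ G, ‖a‖ ≤ M ∧ ‖a₀ - a‖ ≤ 2 * C * r₀ := by
  have hr : ∀ n : ℕ, 0 < r₀ / 2 ^ n ∧ r₀ / 2 ^ n ≤ r₀ := fun n =>
    ⟨by positivity, div_le_self hr₀.le (one_le_pow₀ one_le_two)⟩
  have step' : ∀ (n : ℕ) (a : {a // a ∈ G ∧ ‖a‖ ≤ M + (r₀ / 2 ^ n) ^ 2}),
      ∃ a' : {a // a ∈ G ∧ ‖a‖ ≤ M + (r₀ / 2 ^ (n + 1)) ^ 2},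
        ‖(a : X) - a'‖ ≤ C * (r₀ / 2 ^ n) := fun n a => by
    obtain ⟨a', ha', hn', hd⟩ := step _ (hr n).1 (hr n).2 a a.2.1 a.2.2
    refine ⟨⟨a', ha', hn'.trans_eq ?_⟩, hd⟩
    rw [pow_succ (2 : ℝ) n, div_div]
  choose next hnext using step'
  let s : ∀ n : ℕ, {a // a ∈ G ∧ ‖a‖ ≤ M + (r₀ / 2 ^ n) ^ 2} := fun n =>
    Nat.rec ⟨a₀, ha₀, by simpa using hn⟩ (fun n a => next n a) n
  have hs : ∀ n, dist (s n).1 (s (n + 1)).1 ≤ (2 * C * r₀) / 2 / 2 ^ n := fun n => by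
    rw [dist_eq_norm]
    refine (hnext n (s n)).trans_eq ?_
    ring
  obtain ⟨a, ha⟩ := cauchySeq_tendsto_of_complete
    (cauchySeq_of_le_geometric_two (f := fun n => (s n).1) hs)
  refine ⟨a, hG.mem_of_tendsto ha (Eventually.of_forall fun n => (s n).2.1), ?_, ?_⟩
  · have h1 : Tendsto (fun n : ℕ => M + (r₀ / 2 ^ n) ^ 2) atTop (𝓝 (M + 0 ^ 2)) := by
      refine ((Tendsto.pow ?_ 2).const_add M)
      exact tendsto_const_nhds.div_atTop (tendsto_pow_atTop_atTop_of_one_lt one_lt_two)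
    have := le_of_tendsto_of_tendsto' ha.norm h1 fun n => (s n).2.2
    simpa using this
  · rw [← dist_eq_norm]
    exact dist_le_of_le_geometric_two_of_tendsto₀ hs ha

end Iteration

/-! ### Arens product calculus, complementary projections and annihilators. -/

section Arens

variable {X : Type*} [NonUnitalNormedRing X] [NormedSpace ℂ X]

/-- The canonical embedding of `X` into `X**`. -/
abbrev canon (a : X) : Bidual X := NormedSpace.inclusionInDoubleDual ℂ X a

theorem canon_apply (a : X) (φ : StrongDual ℂ X) : canon a φ = φ a := rfl

theorem norm_canon_le (a : X) : ‖canon a‖ ≤ ‖a‖ := NormedSpace.double_dual_bound ℂ X a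

theorem canon_add (a b : X) : canon (a + b) = canon a + canon b := map_add _ a b

theorem canon_sub (a b : X) : canon (a - b) = canon a - canon b :=
  map_sub (NormedSpace.inclusionInDoubleDual ℂ X) a b

theorem canon_smul (c : ℂ) (a : X) : canon (c • a) = c • canon a := map_smul _ c a

theorem canon_zero : canon (0 : X) = 0 := map_zero _

theorem norm_smul_bidual_le (c : ℂ) (Φ : Bidual X) : ‖c • Φ‖ ≤ ‖c‖ * ‖Φ‖ :=
  ContinuousLinearMap.opNorm_smul_le c Φ

theorem norm_add_bidual_le (Φ Ψ : Bidual X) : ‖Φ + Ψ‖ ≤ ‖Φ‖ + ‖Ψ‖ := norm_add_le Φ Ψ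

variable [IsScalarTower ℂ X X] [SMulCommClass ℂ X X]

theorem arens_canon_apply (a : X) (Ψ : Bidual X) (φ : StrongDual ℂ X) :
    arens (canon a) Ψ φ = Ψ (φ ∘L ContinuousLinearMap.mul ℂ X a) := rfl

theorem canon_mul (a b : X) : canon (a * b) = arens (canon a) (canon b) := rfl

theorem add_arens (Φ₁ Φ₂ Ψ : Bidual X) : arens (Φ₁ + Φ₂) Ψ = arens Φ₁ Ψ + arens Φ₂ Ψ := rfl

theorem sub_arens (Φ₁ Φ₂ Ψ : Bidual X) : arens (Φ₁ - Φ₂) Ψ = arens Φ₁ Ψ - arens Φ₂ Ψ := rfl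

theorem smul_arens (c : ℂ) (Φ Ψ : Bidual X) : arens (c • Φ) Ψ = c • arens Φ Ψ := rfl

theorem zero_arens (Ψ : Bidual X) : arens 0 Ψ = 0 := rfl

theorem arens_add (Φ Ψ₁ Ψ₂ : Bidual X) : arens Φ (Ψ₁ + Ψ₂) = arens Φ Ψ₁ + arens Φ Ψ₂ := by
  ext φ
  exact map_add Φ (dualAct Ψ₁ φ) (dualAct Ψ₂ φ)

theorem arens_sub (Φ Ψ₁ Ψ₂ : Bidual X) : arens Φ (Ψ₁ - Ψ₂) = arens Φ Ψ₁ - arens Φ Ψ₂ := by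
  ext φ
  exact map_sub Φ (dualAct Ψ₁ φ) (dualAct Ψ₂ φ)

theorem arens_smul (c : ℂ) (Φ Ψ : Bidual X) : arens Φ (c • Ψ) = c • arens Φ Ψ := by
  ext φ
  exact map_smul Φ c (dualAct Ψ φ)

theorem arens_zero (Φ : Bidual X) : arens Φ 0 = 0 := by
  ext φ
  exact map_zero Φ

theorem arens_assoc (Φ Ψ Θ : Bidual X) : arens (arens Φ Ψ) Θ = arens Φ (arens Ψ Θ) := by
  ext φ
  rw [arens_apply, arens_apply, arens_apply]
  congr 1
  ext a
  rw [dualAct_apply, dualAct_apply, arens_apply]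
  congr 1
  ext c
  rw [dualAct_apply, ContinuousLinearMap.comp_apply, dualAct_apply]
  congr 1
  ext d
  simp [mul_assoc]

theorem norm_arens_le (Φ Ψ : Bidual X) : ‖arens Φ Ψ‖ ≤ ‖Φ‖ * ‖Ψ‖ := by
  refine ContinuousLinearMap.opNorm_le_bound _ (by positivity) fun φ => ?_
  rw [arens_apply, mul_assoc]
  refine (Φ.le_opNorm _).trans ?_
  gcongr
  refine ContinuousLinearMap.opNorm_le_bound _ (by positivity) fun a => ?_
  rw [dualAct_apply, mul_assoc]
  refine (Ψ.le_opNorm _).trans ?_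
  gcongr
  refine (ContinuousLinearMap.opNorm_comp_le _ _).trans ?_
  gcongr
  exact ContinuousLinearMap.opNorm_mul_apply_le ℂ X a

/-- Complementary projections in the bidual, with sum the identity. -/
structure IsComplPair (q p : Bidual X) : Prop where
  arens_self_left : arens q q = q
  arens_self_right : arens p p = p
  arens_left_right : arens q p = 0
  arens_right_left : arens p q = 0
  norm_left : ‖q‖ ≤ 1
  norm_right : ‖p‖ ≤ 1
  norm_add : ‖q + p‖ ≤ 1
  one_arens : ∀ Φ, arens (q + p) Φ = Φ
  arens_one : ∀ Φ, arens Φ (q + p) = Φ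

theorem IsClosedProjection.exists_isComplPair {q : Bidual X} (hq : IsClosedProjection q) :
    ∃ p, IsComplPair q p ∧ IsOpenProjection p := by
  obtain ⟨hq, e, ⟨hen, he⟩, ho⟩ := hq
  refine ⟨e - q, ⟨hq.1, ho.1.1, ?_, ?_, hq.2, ho.1.2, ?_, ?_, ?_⟩, ho⟩
  · rw [arens_sub, (he q).2, hq.1, sub_self q]
  · rw [sub_arens, (he q).1, hq.1, sub_self q]
  · rwa [add_sub_cancel q e]
  · rw [add_sub_cancel q e]
    exact fun Φ => (he Φ).1
  · rw [add_sub_cancel q e]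
    exact fun Φ => (he Φ).2

/-- The right ideal of `x` with `q x = 0`. -/
def leftAnnihilated (q : Bidual X) : Submodule ℂ X where
  carrier := {x | arens q (canon x) = 0}
  zero_mem' := by
    change arens q (canon 0) = 0
    rw [canon_zero, arens_zero]
  add_mem' {x y} hx hy := by
    change arens q (canon (x + y)) = 0
    rw [canon_add, arens_add, show arens q (canon x) = 0 from hx,
      show arens q (canon y) = 0 from hy, add_zero]
  smul_mem' c x hx := by
    change arens q (canon (c • x)) = 0
    rw [canon_smul, arens_smul, show arens q (canon x) = 0 from hx]
    exact smul_zero (A := Bidual X) c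

/-- The left ideal of `x` with `x q = 0`. -/
def rightAnnihilated (q : Bidual X) : Submodule ℂ X where
  carrier := {x | arens (canon x) q = 0}
  zero_mem' := by
    change arens (canon 0) q = 0
    rw [canon_zero, zero_arens]
  add_mem' {x y} hx hy := by
    change arens (canon (x + y)) q = 0
    rw [canon_add, add_arens, show arens (canon x) q = 0 from hx,
      show arens (canon y) q = 0 from hy, add_zero]
  smul_mem' c x hx := by
    change arens (canon (c • x)) q = 0
    rw [canon_smul, smul_arens, show arens (canon x) q = 0 from hx]
    exact smul_zero (A := Bidual X) c

theorem mem_leftAnnihilated {q : Bidual X} {x : X} :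
    x ∈ leftAnnihilated q ↔ arens q (canon x) = 0 := Iff.rfl

theorem mem_rightAnnihilated {q : Bidual X} {x : X} :
    x ∈ rightAnnihilated q ↔ arens (canon x) q = 0 := Iff.rfl

theorem continuous_arens_left (q : Bidual X) : Continuous fun x : X => arens q (canon x) := by
  let T : X →ₗ[ℂ] Bidual X :=
    { toFun := fun x => arens q (canon x)
      map_add' := fun x y => by rw [canon_add, arens_add]
      map_smul' := fun c x => by rw [canon_smul, arens_smul]; rfl }
  exact AddMonoidHomClass.continuous_of_bound T ‖q‖ fun x =>
    (norm_arens_le _ _).trans (mul_le_mul_of_nonneg_left (norm_canon_le x)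
      (ContinuousLinearMap.opNorm_nonneg q))

theorem continuous_arens_right (q : Bidual X) : Continuous fun x : X => arens (canon x) q := by
  let T : X →ₗ[ℂ] Bidual X :=
    { toFun := fun x => arens (canon x) q
      map_add' := fun x y => by rw [canon_add, add_arens]
      map_smul' := fun c x => by rw [canon_smul, smul_arens]; rfl }
  exact AddMonoidHomClass.continuous_of_bound T ‖q‖ fun x =>
    (norm_arens_le _ _).trans ((mul_le_mul_of_nonneg_right (norm_canon_le x)
      (ContinuousLinearMap.opNorm_nonneg q)).trans_eq
      (mul_comm _ _))

/-- For complementary projections `q`, `p` with `p` open, `p X**` is contained in the weak⋆ closure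
of `{x : q x = 0}`. -/
theorem arens_apply_eq_zero_of_isOpenProjection {q p : Bidual X} (h : IsComplPair q p)
    (hp : IsOpenProjection p) (Ψ : Bidual X) {φ : StrongDual ℂ X}
    (hφ : ∀ x ∈ leftAnnihilated q, φ x = 0) : arens p Ψ φ = 0 := by
  obtain ⟨-, l, hl, hx, hlim⟩ := hp
  -- Each `x = px` in the net satisfies `qx = 0`, and so does every `xc`; thus `φ` vanishes on `xX`.
  have h0 : ∀ᶠ x in l, dualAct Ψ φ x = 0 := by
    filter_upwards [hx] with x hx
    have hx' : arens q (canon x) = 0 := by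
      rw [canon, ← hx, ← arens_assoc, h.arens_left_right, zero_arens]
    have : φ ∘L ContinuousLinearMap.mul ℂ X x = 0 := by
      ext c
      refine hφ _ (mem_leftAnnihilated.2 ?_)
      change arens q (canon (x * c)) = 0
      rw [canon_mul, ← arens_assoc, hx', zero_arens]
    rw [dualAct_apply, this, map_zero]
  exact tendsto_nhds_unique (hlim (dualAct Ψ φ))
    (tendsto_const_nhds.congr' (h0.mono fun x hx => hx.symm))

end Arens

/-! ### Correction steps and interpolation on a closed projection. -/

section Interpolation

variable {X : Type*} [NonUnitalNormedRing X] [NormedSpace ℂ X] [IsScalarTower ℂ X X]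
  [SMulCommClass ℂ X X] {q p : Bidual X}

theorem IsProjection.norm_arens_canon_le (hq : IsProjection q) (x : X) :
    ‖arens q (canon x)‖ ≤ ‖x‖ := by
  calc _ ≤ ‖q‖ * ‖canon x‖ := norm_arens_le _ _
    _ ≤ 1 * ‖x‖ := mul_le_mul hq.2 (norm_canon_le x)
      (ContinuousLinearMap.opNorm_nonneg _) zero_le_one
    _ = _ := one_mul _

/-- Block diagonal elements of the bidual of an operator algebra. -/
theorem IsComplPair.norm_add_le_of_blocks (h : IsComplPair q p) (hX : BidualNormedByReps X)
    {U V : Bidual X} (hU : arens (arens q U) q = U) (hV : arens (arens p V) p = V) {M : ℝ} (hUM : ‖U‖ ≤ M)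
    (hVM : ‖V‖ ≤ M) : ‖U + V‖ ≤ M := by
  refine hX _ ((ContinuousLinearMap.opNorm_nonneg U).trans hUM)
    fun K _ _ _ π hπ hmul => ?_
  rw [bidualRep_add]
  refine OpAlg.norm_add_le_of_blocks (Q := bidualRep π q) (R := bidualRep π p) ?_ ?_ ?_ ?_ ?_ ?_ ?_
    ((norm_bidualRep_le π hπ U).trans hUM) ((norm_bidualRep_le π hπ V).trans hVM)
  · rw [← bidualRep_arens π hmul, h.arens_self_left]
  · rw [← bidualRep_arens π hmul, h.arens_self_right]
  · exact (norm_bidualRep_le π hπ q).trans h.norm_left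
  · rw [← bidualRep_arens π hmul, h.arens_left_right, bidualRep_zero]
  · rw [← bidualRep_add]
    exact (norm_bidualRep_le π hπ _).trans h.norm_add
  · rw [← bidualRep_arens π hmul, ← bidualRep_arens π hmul, hU]
  · rw [← bidualRep_arens π hmul, ← bidualRep_arens π hmul, hV]

theorem IsComplPair.norm_corner_le (h : IsComplPair q p) (hX : BidualNormedByReps X)
    {U : Bidual X} (hU : arens q U = q) {r : ℝ} (hr : 0 ≤ r) (hUr : ‖U‖ ≤ 1 + r) : ‖arens (arens p U) q‖ ≤ √(2 * r + r ^ 2) := by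
  refine hX _ (Real.sqrt_nonneg _) fun K _ _ _ π hπ hmul => ?_
  rw [bidualRep_arens π hmul, bidualRep_arens π hmul]
  refine OpAlg.norm_corner_le ?_ ?_ ?_ ?_ ?_ hr ((norm_bidualRep_le π hπ U).trans hUr)
  · rw [← bidualRep_arens π hmul, h.arens_self_left]
  · exact (norm_bidualRep_le π hπ q).trans h.norm_left
  · rw [← bidualRep_arens π hmul, h.arens_left_right, bidualRep_zero]
  · rw [← bidualRep_add]
    exact (norm_bidualRep_le π hπ _).trans h.norm_add
  · rw [← bidualRep_arens π hmul, hU]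

/-- The compression `p U p` does not increase norms. -/
theorem IsComplPair.norm_compression_le (h : IsComplPair q p) (U : Bidual X) :
    ‖arens (arens p U) p‖ ≤ ‖U‖ := by
  have hU := ContinuousLinearMap.opNorm_nonneg U
  have hp := ContinuousLinearMap.opNorm_nonneg p
  calc _ ≤ ‖arens p U‖ * ‖p‖ := norm_arens_le _ _
    _ ≤ (‖p‖ * ‖U‖) * ‖p‖ := mul_le_mul_of_nonneg_right (norm_arens_le _ _) hp
    _ ≤ ‖U‖ := by nlinarith [h.norm_right, mul_le_mul h.norm_right h.norm_right hp zero_le_one]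

/-- The correction step for elements `a` with `q a = q`. -/
theorem IsComplPair.exists_step_of_arens_eq (h : IsComplPair q p)
    (hX : BidualNormedByReps X) (hp : IsOpenProjection p)
    {r : ℝ} (hr : 0 < r) (hr1 : r ≤ 1) {a : X} (ha : arens q (canon a) = q)
    (han : ‖a‖ ≤ 1 + r ^ 2) :
    ∃ a' : X, arens q (canon a') = q ∧ ‖a'‖ ≤ 1 + (r / 2) ^ 2 ∧ ‖a - a'‖ ≤ 4 * r := by
  set t : ℝ := (1 + r ^ 2)⁻¹ with ht
  have ht0 : 0 < 1 + r ^ 2 := by positivity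
  set V := arens (arens p (canon a)) p with hV
  set W := arens (arens p (canon a)) q with hW
  have hVn : ‖V‖ ≤ 1 + r ^ 2 := (h.norm_compression_le _).trans ((norm_canon_le a).trans han)
  have hWn : ‖W‖ ≤ 2 * r := by
    refine (h.norm_corner_le hX ha (sq_nonneg r) ((norm_canon_le a).trans han)).trans ?_
    rw [Real.sqrt_le_left (by positivity)]
    nlinarith [mul_le_mul hr1 hr1 hr.le zero_le_one, sq_nonneg r]
  have hsum : canon a = q + (W + V) := by
    have h1 := h.one_arens (canon a)
    rw [add_arens, ha] at h1
    have h2 := h.arens_one (arens p (canon a))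
    rw [arens_add] at h2
    rw [hW, hV, h2, h1]
  -- Subtracting `Φ` deletes the corner `paq` and scales `pap` to norm at most one, leaving the
  -- block diagonal `q + t pap`. The left factor `p` puts `Φ` in the weak* closure of `{x : qx =
  -- 0}`.
  set Φ := arens p (arens (canon a) q + ((1 - t : ℝ) : ℂ) • arens (canon a) p) with hΦ
  have hΦ' : Φ = W + ((1 - t : ℝ) : ℂ) • V := by
    rw [hΦ, arens_add, arens_smul, ← arens_assoc, ← arens_assoc]
  have hΦn : ‖Φ‖ ≤ 3 * r := by
    rw [hΦ']
    have h1 : 1 - t = r ^ 2 * (1 + r ^ 2)⁻¹ := by rw [ht]; field_simp; ring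
    have h2 : ‖((1 - t : ℝ) : ℂ) • V‖ ≤ r ^ 2 := by
      calc _ ≤ ‖((1 - t : ℝ) : ℂ)‖ * ‖V‖ := norm_smul_bidual_le _ _
        _ ≤ (r ^ 2 * (1 + r ^ 2)⁻¹) * (1 + r ^ 2) := by
          rw [Complex.norm_real, h1, Real.norm_of_nonneg (by positivity)]
          exact mul_le_mul_of_nonneg_left hVn (by positivity)
        _ = r ^ 2 := by field_simp
    calc _ ≤ ‖W‖ + ‖((1 - t : ℝ) : ℂ) • V‖ := norm_add_bidual_le _ _
      _ ≤ 2 * r + r ^ 2 := add_le_add hWn h2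
      _ ≤ 3 * r := by nlinarith
  have hdiff : canon a - Φ = q + (t : ℂ) • V := by
    rw [hΦ', hsum]
    push_cast
    module
  have hdn : ‖canon a - Φ‖ ≤ 1 := by
    rw [hdiff]
    refine h.norm_add_le_of_blocks hX ?_ ?_ h.norm_left ?_
    · rw [h.arens_self_left, h.arens_self_left]
    · rw [arens_smul, smul_arens, hV]
      congr 1
      rw [← arens_assoc, ← arens_assoc, h.arens_self_right, arens_assoc _ p p, h.arens_self_right]
    · calc _ ≤ ‖(t : ℂ)‖ * ‖V‖ := norm_smul_bidual_le _ _
        _ ≤ (1 + r ^ 2)⁻¹ * (1 + r ^ 2) := by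
          rw [Complex.norm_real, Real.norm_of_nonneg (by positivity)]
          exact mul_le_mul_of_nonneg_left hVn (by positivity)
        _ = 1 := inv_mul_cancel₀ ht0.ne'
  obtain ⟨y, hy, hy1, hy2⟩ := exists_mem_norm_sub_le (leftAnnihilated q) Φ
    (fun φ hφ => arens_apply_eq_zero_of_isOpenProjection h hp _ hφ)
    (ContinuousLinearMap.id ℂ X) (ContinuousLinearMap.id ℂ X) 0 a (α := 3 * r) (β := 1)
    (by positivity) zero_le_one
    (fun f => by
      rw [map_zero, zero_sub, norm_neg]
      exact Φ.le_of_opNorm_le hΦn f)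
    (fun f => (canon a - Φ).le_of_opNorm_le hdn f) (ε := (r / 2) ^ 2) (by positivity)
  rw [ContinuousLinearMap.id_apply] at hy1 hy2
  rw [zero_sub, norm_neg] at hy1
  refine ⟨a - y, ?_, hy2, ?_⟩
  · rw [canon_sub, arens_sub, ha, mem_leftAnnihilated.1 hy, sub_zero q]
  · rw [sub_sub_cancel]
    nlinarith

/-- If `p` is open and `q = 1 - p`, then `p` is in the weak⋆ closure of the hereditary subalgebra
`{x : q x = 0 = x q}`. -/
theorem IsComplPair.apply_eq_zero_of_vanish [CompleteSpace X] (h : IsComplPair q p)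
    (hX : BidualNormedByReps X)
    (hp : IsOpenProjection p) {u : X} (hu : canon u = q + p) {φ : StrongDual ℂ X}
    (hφ : ∀ x ∈ leftAnnihilated q ⊓ rightAnnihilated q, φ x = 0) : p φ = 0 := by
  have hqu : arens q (canon u) = q := by rw [hu, h.arens_one]
  have key : ∀ r : ℝ, 0 < r → r ≤ 1 → ‖p φ‖ ≤ (1 + 8 * ‖φ‖) * r := fun r hr hr1 => by
    -- The first estimate uses that `u - p = q` is contractive; the second, with target `ℂ` and `β =
    -- 0`, makes `φ y` close to `p φ`.
    obtain ⟨y, hy, hy1, hy2⟩ := exists_mem_norm_sub_le (leftAnnihilated q) p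
      (fun φ hφ => by
        rw [← h.arens_one p]
        exact arens_apply_eq_zero_of_isOpenProjection h hp _ hφ)
      (ContinuousLinearMap.id ℂ X) φ u (p φ) (α := 1) (β := 0) zero_le_one le_rfl
      (fun f => by
        have e : f u - p (f ∘L ContinuousLinearMap.id ℂ X) = q f := by
          rw [ContinuousLinearMap.comp_id, ← canon_apply u f, hu]
          exact add_sub_cancel_right (q f) (p f)
        rw [e]
        exact q.le_of_opNorm_le h.norm_left f)
      (fun f => by
        have e : f ∘L φ = f 1 • φ := by
          ext x
          have : φ x = φ x • (1 : ℂ) := by simp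
          rw [ContinuousLinearMap.comp_apply, this, map_smul]
          simp [mul_comm]
        have e' : f (p φ) = p φ * f 1 := by
          conv_lhs => rw [← mul_one (p φ), ← smul_eq_mul, map_smul, smul_eq_mul]
        rw [e, map_smul, e', smul_eq_mul, mul_comm, sub_self, norm_zero, zero_mul])
      (ε := r ^ 2) (by positivity)
    rw [ContinuousLinearMap.id_apply] at hy1
    have hG : IsClosed {a : X | arens q (canon a) = q} :=
      isClosed_eq (continuous_arens_left q) continuous_const
    obtain ⟨a, ha, han, had⟩ := exists_mem_norm_le_of_step hG (M := 1) (C := 4) hr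
      (fun s hs hsr a ha han => h.exists_step_of_arens_eq hX hp hs (hsr.trans hr1) ha han)
      (a₀ := u - y)
      (by
        change arens q (canon (u - y)) = q
        rw [canon_sub, arens_sub, hqu, mem_leftAnnihilated.1 hy, sub_zero q]) hy1
    have ha : arens q (canon a) = q := ha
    have haq : arens (canon a) q = q := by
      -- At `r = 0` the corner estimate gives `paq = 0`.
      have h1 := h.norm_corner_le hX ha le_rfl ((norm_canon_le a).trans (by simpa using han))
      have h2 : arens (arens p (canon a)) q = 0 :=
        ContinuousLinearMap.ext fun ψ => norm_le_zero_iff.1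
          ((ContinuousLinearMap.le_of_opNorm_le _ h1 ψ).trans (by simp))
      have h3 := h.one_arens (arens (canon a) q)
      rw [add_arens, ← arens_assoc, ← arens_assoc, ha, h2, h.arens_self_left] at h3
      rw [← h3, add_zero]
    have hmem : u - a ∈ leftAnnihilated q ⊓ rightAnnihilated q := by
      refine ⟨mem_leftAnnihilated.2 ?_, mem_rightAnnihilated.2 ?_⟩
      · rw [canon_sub, arens_sub, hqu, ha, sub_self q]
      · rw [canon_sub, sub_arens, hu, h.one_arens, haq, sub_self q]
    have e : p φ = (p φ - φ y) - φ ((u - y) - a) := by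
      have := hφ _ hmem
      rw [map_sub] at this
      rw [map_sub, map_sub]
      linear_combination this
    rw [e]
    calc _ ≤ ‖p φ - φ y‖ + ‖φ ((u - y) - a)‖ := norm_sub_le _ _
      _ ≤ (0 + r ^ 2) + ‖φ‖ * (2 * 4 * r) := by
        refine add_le_add hy2 ((φ.le_opNorm _).trans ?_)
        gcongr
      _ ≤ _ := by nlinarith
  by_contra hne
  have hpos : 0 < ‖p φ‖ := norm_pos_iff.2 hne
  have hc : 0 < 1 + 8 * ‖φ‖ := by positivity
  set r := min 1 (‖p φ‖ / (2 * (1 + 8 * ‖φ‖))) with hr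
  have hr0 : 0 < r := lt_min one_pos (by positivity)
  have h1 := key r hr0 (min_le_left _ _)
  have h2 : (1 + 8 * ‖φ‖) * r ≤ (1 + 8 * ‖φ‖) * (‖p φ‖ / (2 * (1 + 8 * ‖φ‖))) := by
    gcongr
    exact min_le_right _ _
  have h3 : (1 + 8 * ‖φ‖) * (‖p φ‖ / (2 * (1 + 8 * ‖φ‖))) = ‖p φ‖ / 2 := by field_simp
  linarith

/-- The correction step for elements of a right ideal `I` that commute with `q`. -/
theorem IsComplPair.exists_step_of_commute [CompleteSpace X] (h : IsComplPair q p)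
    (hX : BidualNormedByReps X)
    (hp : IsOpenProjection p) {u : X} (hu : canon u = q + p) {I : Submodule ℂ X}
    (hI : ∀ a ∈ I, ∀ x, a * x ∈ I) {g : X} (hgI : g ∈ I)
    (hg : arens (canon g) q = arens q (canon g)) {M r : ℝ} (hM : ‖arens (canon g) q‖ ≤ M)
    (hr : 0 < r) (hgn : ‖g‖ ≤ M + r ^ 2) :
    ∃ y ∈ I ⊓ (leftAnnihilated q ⊓ rightAnnihilated q),
      ‖g - y‖ ≤ M + (r / 2) ^ 2 ∧ ‖y‖ ≤ 2 * r ^ 2 := by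
  have hM0 : 0 ≤ M := (ContinuousLinearMap.opNorm_nonneg _).trans hM
  have hs : 0 < M + r ^ 2 := by positivity
  set t : ℝ := M / (M + r ^ 2) with ht
  have ht0 : 0 ≤ t := by positivity
  have ht1 : 1 - t = r ^ 2 / (M + r ^ 2) := by rw [ht]; field_simp; ring
  set V := arens (canon g) p with hV
  have hVn : ‖V‖ ≤ M + r ^ 2 := by
    calc _ ≤ ‖canon g‖ * ‖p‖ := norm_arens_le _ _
      _ ≤ ‖canon g‖ * 1 :=
        mul_le_mul_of_nonneg_left h.norm_right (ContinuousLinearMap.opNorm_nonneg _)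
      _ ≤ _ := by rw [mul_one]; exact (norm_canon_le g).trans hgn
  have hqV : arens q V = 0 := by
    rw [hV, ← arens_assoc, ← hg, arens_assoc, h.arens_left_right, arens_zero]
  have hpV : arens p V = V := by
    have h1 := h.one_arens V
    rw [add_arens, hqV] at h1
    rw [← h1, zero_add, ← arens_assoc, h.arens_self_right]
  have hVp : arens V p = V := by rw [hV, arens_assoc, h.arens_self_right]
  have hsum : canon g = arens (canon g) q + V := by
    rw [hV, ← arens_add, h.arens_one]
  set Φ := ((1 - t : ℝ) : ℂ) • V with hΦ
  have hΦn : ‖Φ‖ ≤ r ^ 2 := by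
    calc _ ≤ ‖((1 - t : ℝ) : ℂ)‖ * ‖V‖ := norm_smul_bidual_le _ _
      _ ≤ (r ^ 2 / (M + r ^ 2)) * (M + r ^ 2) := by
        rw [Complex.norm_real, ht1, Real.norm_of_nonneg (by positivity)]
        exact mul_le_mul_of_nonneg_left hVn (by positivity)
      _ = r ^ 2 := by field_simp
  have hdiff : canon g - Φ = arens (canon g) q + (t : ℂ) • V := by
    rw [hΦ]
    nth_rewrite 1 [hsum]
    push_cast
    module
  have hdn : ‖canon g - Φ‖ ≤ M := by
    rw [hdiff]
    refine h.norm_add_le_of_blocks hX ?_ ?_ hM ?_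
    · rw [← arens_assoc, ← hg, arens_assoc, arens_assoc, h.arens_self_left, h.arens_self_left]
    · rw [arens_smul, smul_arens, hpV, hVp]
    · calc _ ≤ ‖(t : ℂ)‖ * ‖V‖ := norm_smul_bidual_le _ _
        _ ≤ (M / (M + r ^ 2)) * (M + r ^ 2) := by
          rw [Complex.norm_real, Real.norm_of_nonneg ht0]
          exact mul_le_mul_of_nonneg_left hVn ht0
        _ = M := by field_simp
  obtain ⟨y, hy, hy1, hy2⟩ := exists_mem_norm_sub_le
    (I ⊓ (leftAnnihilated q ⊓ rightAnnihilated q)) Φ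
    (fun φ hφ => by
      -- `V = gp` evaluates `p` at `x ↦ φ (g x)`. For `x` killed by `q` on both sides, `g x` is
      -- again so because `g` commutes with `q`, and it stays in the right ideal `I`.
      have : V φ = 0 := by
        rw [hV, arens_canon_apply]
        refine h.apply_eq_zero_of_vanish hX hp hu fun x hx => hφ (g * x) ⟨hI g hgI x, ?_, ?_⟩
        · rw [SetLike.mem_coe, mem_leftAnnihilated, canon_mul, ← arens_assoc, ← hg, arens_assoc,
            mem_leftAnnihilated.1 hx.1, arens_zero]
        · rw [SetLike.mem_coe, mem_rightAnnihilated, canon_mul, arens_assoc,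
            mem_rightAnnihilated.1 hx.2, arens_zero]
      change ((1 - t : ℝ) : ℂ) • V φ = 0
      rw [this, smul_zero])
    (ContinuousLinearMap.id ℂ X) (ContinuousLinearMap.id ℂ X) 0 g (α := r ^ 2) (β := M)
    (by positivity) hM0
    (fun f => by
      rw [map_zero, zero_sub, norm_neg]
      exact Φ.le_of_opNorm_le hΦn f)
    (fun f => (canon g - Φ).le_of_opNorm_le hdn f) (ε := (r / 2) ^ 2) (by positivity)
  rw [ContinuousLinearMap.id_apply] at hy1 hy2
  rw [zero_sub, norm_neg] at hy1
  exact ⟨y, hy, hy2, by nlinarith⟩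

/-- Interpolation on a closed projection `q` by elements of a closed right ideal. -/
theorem IsClosedProjection.exists_interpolation [CompleteSpace X]
    (hX : BidualNormedByReps X) (hq : IsClosedProjection q)
    {u : X} (hu : ∀ x, u * x = x) {I : Submodule ℂ X} (hIc : IsClosed (I : Set X))
    (hI : ∀ a ∈ I, ∀ x, a * x ∈ I) {b : X} (hbI : b ∈ I)
    (hb : arens (canon b) q = arens q (canon b)) :
    ∃ g ∈ I, ‖g‖ ≤ ‖arens (canon b) q‖ ∧ arens (canon g) q = arens (canon b) q ∧
      arens q (canon g) = arens (canon b) q := by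
  obtain ⟨p, h, hp⟩ := hq.exists_isComplPair
  have hu' : canon u = q + p := by
    -- A left unit of `X` suffices: `u(q + p)` equals both `q + p` and `u`.
    have h1 : arens (canon u) (q + p) = q + p := by
      ext φ
      rw [arens_canon_apply]
      congr 1
      ext x
      simp [hu]
    rw [← h1, h.arens_one]
  -- This gives `‖b‖ ≤ r₀²`, so `b` can start the iteration, and `2r² ≤ 2r₀ r` turns the quadratic
  -- step size into the required linear one.
  set r₀ := ‖b‖ + 1 with hr₀
  have hr₀pos : 0 < r₀ := by positivity
  let G : Set X := {g | g ∈ I ∧ arens (canon g) q = arens (canon b) q ∧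
    arens q (canon g) = arens (canon b) q}
  have hG : IsClosed G := hIc.inter
    ((isClosed_eq (continuous_arens_right q) continuous_const).inter
      (isClosed_eq (continuous_arens_left q) continuous_const))
  obtain ⟨g, ⟨hgI, hg1, hg2⟩, hgn, -⟩ := exists_mem_norm_le_of_step hG
    (M := ‖arens (canon b) q‖) (C := 2 * r₀) hr₀pos
    (fun r hr hrr g hg hgn => by
      obtain ⟨hgI, hg1, hg2⟩ := hg
      obtain ⟨y, ⟨hyI, hy1, hy2⟩, hyn, hyr⟩ := h.exists_step_of_commute hX hp hu' hI hgI
        (hg1.trans hg2.symm) (le_of_eq (congrArg _ hg1)) hr hgn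
      refine ⟨g - y, ⟨I.sub_mem hgI hyI, ?_, ?_⟩, hyn, ?_⟩
      · rw [canon_sub, sub_arens, hg1, mem_rightAnnihilated.1 hy2, sub_zero (arens (canon b) q)]
      · rw [canon_sub, arens_sub, hg2, mem_leftAnnihilated.1 hy1, sub_zero (arens (canon b) q)]
      · rw [sub_sub_cancel]
        nlinarith)
    (a₀ := b) ⟨hbI, rfl, hb.symm⟩
    (by nlinarith [norm_nonneg b, ContinuousLinearMap.opNorm_nonneg (arens (canon b) q)])
  exact ⟨g, hgI, hgn, hg1, hg2⟩

end Interpolation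

/-! ### Transfer to `A` as a closed right ideal of its unitization. -/

section Unitization

variable {H : Type*} [NormedAddCommGroup H] [InnerProductSpace ℂ H]
  {A : NonUnitalSubalgebra ℂ (H →L[ℂ] H)}

theorem exists_unit_unitization (A : NonUnitalSubalgebra ℂ (H →L[ℂ] H)) :
    ∃ u : unitization A, ∀ x, u * x = x := by
  by_cases hA : HasNormOneUnit A
  · have hA' : unitization A = A := if_pos hA
    obtain ⟨e, he, -, h⟩ := hA
    exact ⟨⟨e, le_unitization A he⟩, fun x => Subtype.ext (h x (hA'.le x.2)).1⟩
  · refine ⟨⟨1, ?_⟩, fun x => Subtype.ext (one_mul (x : H →L[ℂ] H))⟩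
    have hA : unitization A = addScalars A := if_neg hA
    rw [hA]
    exact ⟨0, A.zero_mem, 1, by simp⟩

theorem mul_mem_of_mem_unitization {a x : H →L[ℂ] H} (ha : a ∈ A) (hx : x ∈ unitization A) :
    a * x ∈ A := by
  unfold unitization at hx
  split_ifs at hx
  · exact A.mul_mem ha hx
  · obtain ⟨c, hc, d, rfl⟩ := hx
    rw [mul_add, mul_smul_comm, mul_one]
    exact A.add_mem (A.mul_mem ha hc) (A.smul_mem d ha)

theorem isClosed_unitization (hA : IsClosed (A : Set (H →L[ℂ] H))) :
    IsClosed (unitization A : Set (H →L[ℂ] H)) := by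
  unfold unitization
  split_ifs
  · exact hA
  · have h := Submodule.isClosed_sup_finiteDimensional A.toSubmodule (ℂ ∙ (1 : H →L[ℂ] H)) hA
    convert h using 1
    ext x
    simp only [SetLike.mem_coe, Submodule.mem_sup, Submodule.mem_span_singleton]
    constructor
    · rintro ⟨a, ha, c, rfl⟩
      exact ⟨a, ha, _, ⟨c, rfl⟩, rfl⟩
    · rintro ⟨a, ha, _, ⟨c, rfl⟩, rfl⟩
      exact ⟨a, ha, c, rfl⟩

theorem toBidual_sub (a b : A) : toBidual (a - b) = toBidual a - toBidual b :=
  canon_sub (NonUnitalSubalgebra.inclusion (le_unitization A) a)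
    (NonUnitalSubalgebra.inclusion (le_unitization A) b)

theorem norm_arens_le_norm_sub {q : UnitizationBidual A} (hq : IsProjection q) {b y : A}
    (hy : y ∈ rightIdeal q) : ‖arens q (toBidual b)‖ ≤ ‖b - y‖ := by
  have e : arens q (toBidual b) = arens q (toBidual (b - y)) := by
    rw [toBidual_sub, arens_sub, show arens q (toBidual y) = 0 from hy]
    exact (sub_zero (arens q (toBidual b))).symm
  rw [e]
  exact hq.norm_arens_canon_le (NonUnitalSubalgebra.inclusion (le_unitization A) (b - y))

/-- Interpolation on a closed projection of `(A¹)**` by elements of `A`. -/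
theorem exists_interpolation [CompleteSpace H] (hA : IsClosed (A : Set (H →L[ℂ] H)))
    {q : UnitizationBidual A} (hq : IsClosedProjection q) {b : A}
    (hb : arens (toBidual b) q = arens q (toBidual b)) :
    ∃ g : A, ‖g‖ ≤ ‖arens (toBidual b) q‖ ∧ arens (toBidual g) q = arens (toBidual b) q ∧
      arens q (toBidual g) = arens (toBidual b) q := by
  obtain ⟨u, hu⟩ := exists_unit_unitization A
  have : CompleteSpace (unitization A) := (isClosed_unitization hA).completeSpace_coe
  let I : Submodule ℂ (unitization A) :=
    A.toSubmodule.comap (unitization A).toSubmodule.subtype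
  have hIc : IsClosed (I : Set (unitization A)) := hA.preimage continuous_subtype_val
  obtain ⟨g, hgI, hg⟩ := hq.exists_interpolation (bidualNormedByReps_of_subalgebra _) hu hIc
    (fun a ha x => mul_mem_of_mem_unitization ha x.2)
    (b := NonUnitalSubalgebra.inclusion (le_unitization A) b) b.2 hb
  exact ⟨⟨g, hgI⟩, hg⟩

end Unitization

end OpAlg

end

theorem theorem5p1 {H : Type*} [NormedAddCommGroup H] [InnerProductSpace ℂ H] [CompleteSpace H]
    (A : NonUnitalSubalgebra ℂ (H →L[ℂ] H)) (hA : IsClosed (A : Set (H →L[ℂ] H)))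
    (q : OpAlg.UnitizationBidual A) (hq : OpAlg.IsClosedProjection q)
    (b : A) (hb : OpAlg.arens (OpAlg.toBidual b) q = OpAlg.arens q (OpAlg.toBidual b)) :
    (∃ y ∈ OpAlg.rightIdeal q, ‖b - y‖ = Metric.infDist b (OpAlg.rightIdeal q)) ∧
      (‖OpAlg.arens (OpAlg.toBidual b) q‖ ≤ 1 →
        ∃ g : A, ‖g‖ ≤ 1 ∧
          OpAlg.arens (OpAlg.toBidual g) q = OpAlg.arens (OpAlg.toBidual b) q ∧
          OpAlg.arens q (OpAlg.toBidual g) = OpAlg.arens (OpAlg.toBidual b) q) := by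
  obtain ⟨g, hgn, hg1, hg2⟩ := OpAlg.exists_interpolation hA hq hb
  have hmem : b - g ∈ OpAlg.rightIdeal q := by
    change OpAlg.arens q (OpAlg.toBidual (b - g)) = 0
    rw [OpAlg.toBidual_sub, OpAlg.arens_sub, hg2, hb]
    exact sub_self (OpAlg.arens q (OpAlg.toBidual b))
  refine ⟨⟨b - g, hmem, le_antisymm ?_ ?_⟩, fun h => ⟨g, hgn.trans h, hg1, hg2⟩⟩
  · rw [sub_sub_cancel]
    refine (Metric.le_infDist ⟨_, hmem⟩).2 fun y hy => ?_
    rw [dist_eq_norm]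
    refine hgn.trans ?_
    rw [hb]
    exact OpAlg.norm_arens_le_norm_sub hq.1 hy
  · rw [← dist_eq_norm]
    exact Metric.infDist_le_dist_of_mem hmem
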